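/- Let $p$ be a prime, $\mathbb{F}$ a finite field of characteristic $p$, $G$ a profinite group, $H \lhd G$ an open subgroup of index $2$ and $\sigma \in G\setminus H$. Let $\bar\chi : H \to \mathbb{F}^\times$ be a continuous character with $\bar\chi \ne \bar\chi^\sigma$, where $\bar\chi^\sigma(h) = \bar\chi(\sigma h\sigma^{-1})$, and let $\bar\rho : G \to \mathrm{GL}_2(\mathbb{F})$ be a continuous representation equivalent to $\mathrm{Ind}_H^G(\bar\chi)$ (the condition $\bar\chi\neq\bar\chi^\sigma$ means that $\bar\rho$ is absolutely irreducible). Here, for a commutative ring $A$ and a character $\chi : H \to A^\times$, $\mathrm{Ind}_H^G(\chi)$ is the $A$-module of all maps $f : G \to A$ with $f(hg) = \chi(h)f(g)$ for $h\in H$, $g \in G$, with $G$ acting by $(\tilde g f)(g) = f(g\tilde g)$. Let $R$ be a complete local Noetherian $W(\mathbb{F})$-algebra with residue field $\mathbb{F}$ and maximal ideal $\mathfrak{m}_R$, with its $\mathfrak{m}_R$-adic topology, and let $\rho : G \to \mathrm{GL}_2(R)$ be a continuous lift of $\bar\rho$. Let $\Gamma_\rho$ be the kernel of the reduction map $\mathrm{Im}(\rho)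 \to \mathrm{Im}(\bar\rho)$, let $\Phi(\Gamma_\rho)$ be its $p$-Frattini subgroup, i.e. the closure of $\Gamma_\rho^p[\Gamma_\rho,\Gamma_\rho]$, and let $\overline{H}^{\mathrm{ad}}$ be the image of $H$ under the adjoint representation of $\bar\rho$ (conjugation on $M_2(\mathbb{F})$). The exact sequence $1 \to \Gamma_\rho \to \rho(H) \to \bar\rho(H) \to 1$ splits. Let $s : \bar\rho(H) \to \rho(H)$ be any splitting. The conjugation action of $\bar\rho(H)$ on $\Gamma_\rho$ via $s$ factors through $\overline{H}^{\mathrm{ad}}$, and for the resulting action of $\overline{H}^{\mathrm{ad}}$ on $\Gamma_\rho$ the following are equivalent: (i) $\rho$ is dihedral, i.e. there is a continuous character $\chi : H \to R^\times$ lifting $\bar\chi$ such that $\rho$ is equivalent to $\mathrm{Ind}_H^G(\chi)$; (ii) the action of $\overline{H}^{\mathrm{ad}}$ on $\Gamma_\rho$ is trivial; (iii) the induced action of $\overline{H}^{\mathrm{ad}}$ on $\Gamma_\rho/\Phi(\Gamma_\rho)$ is trivial. Moreover, if (ii) holds, then multiplication $(\gamma, t) \mapsto \gamma t$ is an isomorphism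 of topological groups $\Gamma_\rho \times s(\bar\rho(H)) \cong \rho(H)$. -/

import Mathlib

namespace DihedralLift

section Induction

variable {G : Type*} [Group G] {R : Type*} [CommRing R]

/-- A character `χ : H → Rˣ`, seen as a representation of `H` on the free module `R`. -/
def charRep {H : Subgroup G} (χ : H →* Rˣ) : Representation R H R where
  toFun h := (χ h : R) • LinearMap.id
  map_one' := by ext; simp
  map_mul' a b := by ext; simp [mul_comm]

/-- `Ind_H^G(χ)_R`: the module of all maps `f : G → R` with `f (h g) = χ(h) f(g)` for `h ∈ H`,
`g ∈ G`, on which `G` acts by `(g'.f)(g) = f (g g')`. -/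
abbrev inducedRep {H : Subgroup G} (χ : H →* Rˣ) :
    Representation R G (Representation.coindV H.subtype (charRep χ)) :=
  Representation.coind H.subtype (charRep χ)

/-- The representation of `G` on `R²` (column vectors) given by `ρ : G → GL₂(R)`. -/
def matrixRep (ρ : G →* GL (Fin 2) R) : Representation R G (Fin 2 → R) where
  toFun g := Matrix.mulVecLin (ρ g : Matrix (Fin 2) (Fin 2) R)
  map_one' := by ext; simp
  map_mul' a b := by simp [Matrix.mulVecLin_mul, Module.End.mul_eq_comp]

/-- `ρ` is equivalent to the induction of `χ` from `H` to `G`: the two representations are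
isomorphic as `R[G]`-modules. -/
def IsInducedFrom (ρ : G →* GL (Fin 2) R) {H : Subgroup G} (χ : H →* Rˣ) : Prop :=
  Nonempty ((matrixRep ρ).Equiv (inducedRep χ))

/-- The adjoint representation of `ρ`: the action of `G` on `M₂(R)` by conjugation through `ρ`. -/
def adjointRep (ρ : G →* GL (Fin 2) R) :
    Representation R G (Matrix (Fin 2) (Fin 2) R) where
  toFun g := LinearMap.mulLeftRight R
    ((ρ g : Matrix (Fin 2) (Fin 2) R), ((ρ g)⁻¹ : GL (Fin 2) R).val)
  map_one' := by ext1 A; simp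
  map_mul' a b := by
    refine LinearMap.ext fun A => ?_
    simp only [map_mul, mul_inv_rev, Units.val_mul, Module.End.mul_apply,
      LinearMap.mulLeftRight_apply, mul_assoc]

/-- The image of `H` under the adjoint representation of `ρ`. -/
def adImage (ρ : G →* GL (Fin 2) R) (H : Subgroup G) :
    Subgroup (Module.End R (Matrix (Fin 2) (Fin 2) R))ˣ :=
  H.map (adjointRep ρ).asGroupHom

end Induction

section Frattini

/-- The `p`-Frattini subgroup of `Γ`: the closure of `Γ^p [Γ, Γ]`, where `Γ^p` is the subgroup
generated by the `p`-th powers. -/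
def pFrattini (p : ℕ) (Γ : Type*) [Group Γ] [TopologicalSpace Γ] [IsTopologicalGroup Γ] :
    Subgroup Γ :=
  (Subgroup.closure (Set.range fun x : Γ => x ^ p) ⊔ commutator Γ).topologicalClosure

end Frattini

section Lift

variable {G : Type*} [Group G] {R : Type*} [CommRing R] {F : Type*} [Field F]

/-- `Γ_ρ`: the kernel of the reduction map `Im(ρ) → Im(ρbar)`, as a subgroup of `GL₂(R)`;
`π : R → F` is the residue map. -/
def kernelGamma (π : R →+* F) (ρ : G →* GL (Fin 2) R) : Subgroup (GL (Fin 2) R) :=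
  ρ.range ⊓ (Matrix.GeneralLinearGroup.map (n := Fin 2) π).ker

/-- `s` is a splitting of the exact sequence `1 → Γ_ρ → ρ(H) → ρbar(H) → 1`. -/
structure IsSplitting (π : R →+* F) (ρ : G →* GL (Fin 2) R) (ρbar : G →* GL (Fin 2) F)
    (H : Subgroup G) (s : H.map ρbar →* GL (Fin 2) R) : Prop where
  mem_image : ∀ x, s x ∈ H.map ρ
  reduction : ∀ x, Matrix.GeneralLinearGroup.map (n := Fin 2) π (s x) = x

/-- `act` is the action of the adjoint image of `H` on `Γ_ρ` induced by `s`: for `h ∈ H`, the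
image of `h` acts by conjugation with `s (ρbar h)`. There is at most one such action. -/
def IsConjAction (π : R →+* F) (ρ : G →* GL (Fin 2) R) (ρbar : G →* GL (Fin 2) F)
    (H : Subgroup G) (s : H.map ρbar →* GL (Fin 2) R)
    (act : adImage ρbar H →* MulAut (kernelGamma π ρ)) : Prop :=
  ∀ (h : G) (hh : h ∈ H) (γ : kernelGamma π ρ),
    (act ⟨(adjointRep ρbar).asGroupHom h, Subgroup.mem_map_of_mem _ hh⟩ γ : GL (Fin 2) R) =
      s ⟨ρbar h, Subgroup.mem_map_of_mem _ hh⟩ * γ *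
        (s ⟨ρbar h, Subgroup.mem_map_of_mem _ hh⟩)⁻¹

end Lift

end DihedralLift

namespace DihedralLift

/-! ### Induction from an index-two subgroup, in terms of rows of matrices. -/

section Induction

variable {G : Type*} [Group G] {R : Type*} [CommRing R]

/-! In a suitable basis `Q`, `ρbar` restricted to `H` is diagonal with characters `χbar` and its
`σ`-conjugate. A finite group of diagonal matrices in characteristic `p` has order prime to `p`,
while the kernel of reduction is pro-`p`, so Schur–Zassenhaus and compactness provide a splitting.
For any splitting `s`, averaging lifts `Q` to a matrix `M` over `R` that diagonalizes `s`, with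
Teichmüller lifts as eigenvalues (`exists_diagonalization`). If `h` acts trivially by the adjoint
representation, its two eigenvalues agree, so `s (ρbar h)` is scalar and conjugation by it is
trivial; hence the action factors.

If `ρ` is induced, `ρ(H)` is commutative and contains both `Γ_ρ` and the image of `s`, so the action
is trivial.

The substantial implication is from triviality modulo Frattini to dihedral
(`apply_zero_one_eq_zero`). Choose `h₀` whose two residual eigenvalues differ. In the basis `M`,
conjugation by its lift multiplies the upper right entry of `γ` by a unit not congruent to 1. If all
these entries lie in `m ^ k` with `k ≥ 1`, then modulo `m ^ (k + 1)` the entry is an additive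
character of `Γ_ρ` that kills the Frattini subgroup. It is both fixed and rescaled, hence zero, and
induction puts the entry in every power of `m`.

Thus `ρ(H)`, the product of `Γ_ρ` and the diagonalized image of `s`, is lower triangular. The first
row of `M` is then an eigenvector for a character `χ` of `H`; with its translate by `σ` it forms a
matrix reducing to `Q`, hence a basis, and this identifies `ρ` with the induction of `χ`
(`isInducedFrom_of_row`). -/

theorem apply_mul_of_mem_coindV {H : Subgroup G} {χ : H →* Rˣ}
    (f : Representation.coindV H.subtype (charRep χ)) (h : H) (g : G) :
    f.1 (h * g) = (χ h : R) * f.1 g := by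
  have := f.2 h g
  simpa [charRep] using this

theorem exists_mul_of_index_two {H : Subgroup G} (hH : H.index = 2) {σ : G} (hσ : σ ∉ H)
    {g : G} (hg : g ∉ H) : ∃ h : H, g = h * σ := by
  refine ⟨⟨g * σ⁻¹, ?_⟩, by simp⟩
  rw [Subgroup.mul_mem_iff_of_index_two hH]
  simp [hg, hσ]

theorem coindV_ext {H : Subgroup G} (hH : H.index = 2) {σ : G} (hσ : σ ∉ H) {χ : H →* Rˣ}
    {f f' : Representation.coindV H.subtype (charRep χ)}
    (h1 : f.1 1 = f'.1 1) (h2 : f.1 σ = f'.1 σ) : f = f' := by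
  apply Subtype.ext
  funext g
  by_cases hg : g ∈ H
  · have e1 := apply_mul_of_mem_coindV f ⟨g, hg⟩ 1
    have e2 := apply_mul_of_mem_coindV f' ⟨g, hg⟩ 1
    simp only [mul_one] at e1 e2
    rw [e1, e2, h1]
  · obtain ⟨h, rfl⟩ := exists_mul_of_index_two hH hσ hg
    rw [apply_mul_of_mem_coindV, apply_mul_of_mem_coindV, h2]

theorem equiv_matrixRep_apply {ρ : G →* GL (Fin 2) R} {H : Subgroup G} {χ : H →* Rˣ}
    (e : (matrixRep ρ).Equiv (inducedRep χ)) (g x : G) (v : Fin 2 → R) :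
    (e ((ρ g).val.mulVec v)).1 x = (e v).1 (x * g) := by
  have := LinearMap.congr_fun (e.isIntertwining' g) v
  exact congrArg (fun f : Representation.coindV H.subtype (charRep χ) => f.1 x) this

/-- If `ρ` is induced from a normal subgroup, then that subgroup has commutative image. -/
theorem IsInducedFrom.commute {ρ : G →* GL (Fin 2) R} {H : Subgroup G} [H.Normal] {χ : H →* Rˣ}
    (hρ : IsInducedFrom ρ χ) {a b : G} (ha : a ∈ H) (hb : b ∈ H) :
    ρ a * ρ b = ρ b * ρ a := by
  obtain ⟨e⟩ := hρ
  apply Units.ext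
  apply Matrix.mulVec_injective
  funext v
  apply e.toLinearEquiv.injective
  apply Subtype.ext
  funext x
  -- Under evaluation at `x`, `a` acts through the scalar `χ (x * a * x⁻¹)`; such scalars commute.
  have key (a b : G) (ha : a ∈ H) (hb : b ∈ H) :
      (e ((ρ a * ρ b).val.mulVec v)).1 x =
        (χ ⟨x * a * x⁻¹, Subgroup.Normal.conj_mem ‹_› a ha x⟩ *
          χ ⟨x * b * x⁻¹, Subgroup.Normal.conj_mem ‹_› b hb x⟩ : R) * (e v).1 x := by
    rw [← map_mul, equiv_matrixRep_apply, mul_assoc, ← apply_mul_of_mem_coindV,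
      ← apply_mul_of_mem_coindV]
    simp [mul_assoc]
  have h1 := key a b ha hb
  have h2 := key b a hb ha
  rw [mul_comm (χ _ : R)] at h2
  exact h1.trans h2.symm

/-- A row vector on which `H` acts through `χ` and which, together with its translate by `σ`, forms
an invertible matrix exhibits `ρ` as induced from `χ`. -/
theorem isInducedFrom_of_row {ρ : G →* GL (Fin 2) R} {H : Subgroup G} (hH : H.index = 2)
    {σ : G} (hσ : σ ∉ H) {χ : H →* Rˣ} (w : Fin 2 → R)
    (hw : ∀ h : H, Matrix.vecMul w (ρ h).val = (χ h : R) • w)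
    (hdet : IsUnit (Matrix.of ![w, Matrix.vecMul w (ρ σ).val])) : IsInducedFrom ρ χ := by
  let L : (Fin 2 → R) →ₗ[R] Representation.coindV H.subtype (charRep χ) :=
    { toFun := fun v => ⟨fun g => dotProduct w ((ρ g).val.mulVec v), fun h g => by
        change dotProduct w ((ρ (h * g)).val.mulVec v) =
          (χ h : R) • dotProduct w ((ρ g).val.mulVec v)
        rw [map_mul, Units.val_mul, ← Matrix.mulVec_mulVec, Matrix.dotProduct_mulVec w (ρ h).val,
          hw, smul_dotProduct]⟩
      map_add' := fun v v' => Subtype.ext <| funext fun g =>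
        (congrArg (dotProduct w) (Matrix.mulVec_add _ v v')).trans (dotProduct_add _ _ _)
      map_smul' := fun c v => Subtype.ext <| funext fun g =>
        (congrArg (dotProduct w) (Matrix.mulVec_smul _ c v)).trans (dotProduct_smul _ _ _) }
  have hL (v : Fin 2 → R) (g : G) : (L v).1 g = dotProduct w ((ρ g).val.mulVec v) := rfl
  have hN (v : Fin 2 → R) :
      (Matrix.of ![w, Matrix.vecMul w (ρ σ).val]).mulVec v = ![(L v).1 1, (L v).1 σ] := by
    ext i
    fin_cases i
    · change dotProduct w v = dotProduct w ((ρ 1).val.mulVec v)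
      rw [map_one, Units.val_one, Matrix.one_mulVec]
    · exact (Matrix.dotProduct_mulVec w (ρ σ).val v).symm
  have hbij : Function.Bijective L := by
    constructor
    · intro v v' hvv
      apply Matrix.mulVec_injective_of_isUnit hdet
      change (Matrix.of ![w, Matrix.vecMul w (ρ σ).val]).mulVec v =
        (Matrix.of ![w, Matrix.vecMul w (ρ σ).val]).mulVec v'
      rw [hN, hN, hvv]
    · intro f
      obtain ⟨u, hu⟩ := hdet
      -- A function in the induced module is determined by its values at the coset representatives
      -- `1` and `σ`, so the preimage solves a 2 × 2 system.
      refine ⟨u⁻¹.val.mulVec ![f.1 1, f.1 σ], ?_⟩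
      have := hN (u⁻¹.val.mulVec ![f.1 1, f.1 σ])
      rw [← hu, Matrix.mulVec_mulVec, Units.mul_inv, Matrix.one_mulVec] at this
      exact coindV_ext hH hσ (congrFun this 0).symm (congrFun this 1).symm
  exact ⟨Representation.Equiv.mk (LinearEquiv.ofBijective L hbij) fun g => by
    refine LinearMap.ext fun v => Subtype.ext <| funext fun x => ?_
    change dotProduct w ((ρ x).val.mulVec ((ρ g).val.mulVec v)) =
      dotProduct w ((ρ (x * g)).val.mulVec v)
    rw [Matrix.mulVec_mulVec, map_mul, Units.val_mul]⟩

/-- Over a field, an induced representation is diagonal on `H` after the base change by the matrix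
whose rows are evaluation at `1` and at `σ`. -/
theorem IsInducedFrom.exists_rows {K : Type*} [Field K] {ρ : G →* GL (Fin 2) K} {H : Subgroup G}
    [H.Normal] (hH : H.index = 2) {σ : G} (hσ : σ ∉ H) {χ : H →* Kˣ} (hρ : IsInducedFrom ρ χ) :
    ∃ Q : GL (Fin 2) K,
      (∀ h : H, Matrix.vecMul (Q.val 0) (ρ h).val = (χ h : K) • Q.val 0) ∧
      (∀ h : H, Matrix.vecMul (Q.val 1) (ρ h).val =
        (χ (MulAut.conjNormal σ h) : K) • Q.val 1) ∧
      Q.val 1 = Matrix.vecMul (Q.val 0) (ρ σ).val := by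
  obtain ⟨e⟩ := hρ
  let N : Matrix (Fin 2) (Fin 2) K :=
    LinearMap.toMatrix' (LinearMap.pi fun i : Fin 2 =>
      LinearMap.proj (![1, σ] i) ∘ₗ Submodule.subtype _ ∘ₗ e.toLinearEquiv.toLinearMap)
  have hN (v : Fin 2 → K) (i : Fin 2) : dotProduct (N i) v = (e v).1 (![1, σ] i) := by
    change N.mulVec v i = _
    simp only [N, LinearMap.toMatrix'_mulVec]
    rfl
  have hu : IsUnit N := by
    rw [← Matrix.mulVec_injective_iff_isUnit]
    intro v v' hvv
    apply e.toLinearEquiv.injective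
    apply coindV_ext hH hσ
    · have := congrFun hvv 0
      change dotProduct (N 0) v = dotProduct (N 0) v' at this
      rwa [hN, hN] at this
    · have := congrFun hvv 1
      change dotProduct (N 1) v = dotProduct (N 1) v' at this
      rwa [hN, hN] at this
  have ext_row {x y : Fin 2 → K} (hxy : ∀ v, dotProduct x v = dotProduct y v) : x = y :=
    dotProduct_eq _ _ hxy
  refine ⟨hu.unit, fun h => ext_row fun v => ?_, fun h => ext_row fun v => ?_,
    ext_row fun v => ?_⟩
  · rw [← Matrix.dotProduct_mulVec, smul_dotProduct]
    change dotProduct (N 0) _ = _ • dotProduct (N 0) _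
    rw [hN, hN, equiv_matrixRep_apply, smul_eq_mul, ← apply_mul_of_mem_coindV]
    simp
  · rw [← Matrix.dotProduct_mulVec, smul_dotProduct]
    change dotProduct (N 1) _ = _ • dotProduct (N 1) _
    rw [hN, hN, equiv_matrixRep_apply, smul_eq_mul, ← apply_mul_of_mem_coindV]
    simp
  · rw [← Matrix.dotProduct_mulVec]
    change dotProduct (N 1) _ = dotProduct (N 0) _
    rw [hN, hN, equiv_matrixRep_apply]
    simp

end Induction

/-! ### Schur–Zassenhaus, finite and profinite. -/

section Splitting

/-- Finite-level form of Schur–Zassenhaus: a surjection onto a group of order prime to `p` whose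
kernel is a `p`-group modulo `U` has a section that is multiplicative modulo `U`. -/
theorem exists_section_mul_mod {K A : Type*} [Group K] [Group A] [Finite A] (p : ℕ)
    [Fact p.Prime] (hA : ¬ p ∣ Nat.card A) (f : K →* A) (hf : Function.Surjective f)
    (U : Subgroup K) [U.Normal] [U.FiniteIndex] (hU : U ≤ f.ker)
    (hp : ∀ x ∈ f.ker, ∃ k : ℕ, x ^ p ^ k ∈ U) :
    ∃ s : A → K, (∀ a, f (s a) = a) ∧ ∀ a b, s a * s b * (s (a * b))⁻¹ ∈ U := by
  let f' : K ⧸ U →* A := QuotientGroup.lift U f hU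
  have hf' : Function.Surjective f' := fun a => by
    obtain ⟨x, rfl⟩ := hf a
    exact ⟨QuotientGroup.mk x, rfl⟩
  have hN : IsPGroup p f'.ker := by
    rintro ⟨y, hy⟩
    induction y using QuotientGroup.induction_on with
    | H x =>
      obtain ⟨k, hk⟩ := hp x hy
      refine ⟨k, Subtype.ext ?_⟩
      change (QuotientGroup.mk x : K ⧸ U) ^ p ^ k = 1
      rwa [← QuotientGroup.mk_pow, QuotientGroup.eq_one_iff]
  have hindex : f'.ker.index = Nat.card A := by
    rw [Subgroup.index_ker, f'.range_eq_top_of_surjective hf', Subgroup.card_top]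
  obtain ⟨n, hn⟩ := IsPGroup.iff_card.1 hN
  have hcop : (Nat.card f'.ker).Coprime f'.ker.index := by
    rw [hn, hindex]
    exact Nat.Coprime.pow_left _ ((Nat.Prime.coprime_iff_not_dvd Fact.out).2 hA)
  obtain ⟨B, hB⟩ := Subgroup.exists_right_complement'_of_coprime hcop
  have hinj {x y : K ⧸ U} (hx : x ∈ B) (hy : y ∈ B) (hxy : f' x = f' y) : x = y := by
    have h1 : x * y⁻¹ ∈ f'.ker := by simp [MonoidHom.mem_ker, hxy]
    exact mul_inv_eq_one.1 (Subgroup.disjoint_def.1 hB.disjoint h1 (B.mul_mem hx (B.inv_mem hy)))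
  have hex (a : A) : ∃ x : K, f x = a ∧ (QuotientGroup.mk x : K ⧸ U) ∈ B := by
    obtain ⟨y, rfl⟩ := hf' a
    obtain ⟨⟨⟨u, hu⟩, ⟨b, hb⟩⟩, rfl⟩ := hB.2 y
    induction b using QuotientGroup.induction_on with
    | H x =>
      refine ⟨x, ?_, hb⟩
      change f x = f' (u * QuotientGroup.mk x)
      rw [map_mul, MonoidHom.mem_ker.1 hu, one_mul]
      rfl
  choose s hs hsB using hex
  refine ⟨s, hs, fun a b => ?_⟩
  rw [← QuotientGroup.eq_one_iff, QuotientGroup.mk_mul, QuotientGroup.mk_inv, mul_inv_eq_one]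
  refine hinj (B.mul_mem (hsB a) (hsB b)) (hsB _) ?_
  change f (s a * s b) = f (s (a * b))
  rw [map_mul, hs, hs, hs]

/-- Schur–Zassenhaus for a compact group whose normal subgroup is pro-`p`, with quotient of finite
order prime to `p`. -/
theorem exists_rightInverse_of_pro_p_ker {K A : Type*} [Group K] [TopologicalSpace K]
    [IsTopologicalGroup K] [CompactSpace K] [Group A] [Finite A] [TopologicalSpace A]
    [DiscreteTopology A] (p : ℕ) [Fact p.Prime] (hA : ¬ p ∣ Nat.card A) (f : K →* A)
    (hfc : Continuous f) (hf : Function.Surjective f) (U : ℕ → Subgroup K) [∀ n, (U n).Normal]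
    (hopen : ∀ n, IsOpen (U n : Set K)) (hanti : Antitone U) (hU : ∀ n, U n ≤ f.ker)
    (hbot : ∀ x, (∀ n, x ∈ U n) → x = 1)
    (hp : ∀ n, ∀ x ∈ f.ker, ∃ k : ℕ, x ^ p ^ k ∈ U n) :
    ∃ s : A →* K, ∀ a, f (s a) = a := by
  -- Approximate sections form a decreasing sequence of nonempty closed subsets of the compact space
  -- `A → K`; a point of their intersection is an exact section.
  let S : ℕ → Set (A → K) := fun n =>
    {s | (∀ a, f (s a) = a) ∧ ∀ a b, s a * s b * (s (a * b))⁻¹ ∈ U n}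
  have hfin (n : ℕ) : (U n).FiniteIndex := by
    have := Subgroup.quotient_finite_of_isOpen (U n) (hopen n)
    exact Subgroup.finiteIndex_of_finite_quotient
  have hclosed (n : ℕ) : IsClosed (S n) := by
    have h1 : IsClosed {s : A → K | ∀ a, f (s a) = a} := by
      rw [Set.ofPred_forall]
      exact isClosed_iInter fun a =>
        isClosed_eq (hfc.comp (continuous_apply a)) continuous_const
    have h2 : IsClosed {s : A → K | ∀ a b, s a * s b * (s (a * b))⁻¹ ∈ U n} := by
      simp only [Set.ofPred_forall]
      refine isClosed_iInter fun a => isClosed_iInter fun b => ?_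
      have hc : Continuous fun s : A → K => s a * s b * (s (a * b))⁻¹ := by fun_prop
      exact ((U n).isClosed_of_isOpen (hopen n)).preimage hc
    exact h1.inter h2
  obtain ⟨s, hs⟩ := IsCompact.nonempty_iInter_of_sequence_nonempty_isCompact_isClosed S
    (fun n s hs => ⟨hs.1, fun a b => hanti n.le_succ (hs.2 a b)⟩)
    (fun n => exists_section_mul_mod p hA f hf (U n) (hU n) (hp n))
    (hclosed 0).isCompact hclosed
  rw [Set.mem_iInter] at hs
  refine ⟨MonoidHom.mk' s fun a b => ?_, (hs 0).1⟩
  exact (mul_inv_eq_one.1 (hbot _ fun n => (hs n).2 a b)).symm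

end Splitting

/-! ### Rigidity of lifts by averaging. -/

section Conjugacy

open Matrix

variable {R F : Type*} [CommRing R] [CommRing F] {n : Type*} [Fintype n] [DecidableEq n]

/-- Two homomorphisms from a finite group of invertible order to `GLₙ(R)` with the same reduction
are conjugate by a matrix reducing to the identity. -/
theorem exists_conj_of_map_eq (π : R →+* F) [IsLocalHom π] {A : Type*} [Group A] [Finite A]
    (hA : IsUnit (Nat.card A : R)) (s t : A →* GL n R)
    (hst : ∀ a, GeneralLinearGroup.map π (s a) = GeneralLinearGroup.map π (t a)) :
    ∃ C : GL n R, GeneralLinearGroup.map π C = 1 ∧ ∀ a, s a * C = C * t a := by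
  have := Fintype.ofFinite A
  obtain ⟨u, hu⟩ := hA
  -- The average of `s a * (t a)⁻¹` intertwines `t` with `s`, and each term reduces to 1.
  let X : Matrix n n R := (u⁻¹).val • ∑ a, (s a * (t a)⁻¹ : GL n R).val
  have hX : X.map π = 1 := by
    have h (a : A) : π.mapMatrix (s a * (t a)⁻¹ : GL n R).val = 1 := by
      have : GeneralLinearGroup.map π (s a * (t a)⁻¹) = 1 := by
        rw [map_mul, map_inv, hst, mul_inv_cancel]
      exact congrArg Units.val this
    have h2 : π.mapMatrix (∑ a, (s a * (t a)⁻¹ : GL n R).val) = (Nat.card A : Matrix n n F) := by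
      rw [map_sum, Finset.sum_congr rfl fun a _ => h a]
      simp
    have h3 : X.map π = π (u⁻¹).val • π.mapMatrix (∑ a, (s a * (t a)⁻¹ : GL n R).val) := by
      ext i j
      exact map_mul π _ _
    have h4 : π (u⁻¹).val * (Nat.card A : F) = 1 := by
      rw [← map_natCast π, ← map_mul, ← hu, Units.inv_mul, map_one]
    rw [h3, h2, ← nsmul_one, ← Nat.cast_smul_eq_nsmul F, smul_smul, h4, one_smul]
  have hXu : IsUnit X := by
    rw [Matrix.isUnit_iff_isUnit_det]
    apply isUnit_of_map_unit π
    rw [RingHom.map_det, RingHom.mapMatrix_apply, hX, det_one]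
    exact isUnit_one
  refine ⟨hXu.unit, Units.ext hX, fun b => Units.ext ?_⟩
  change (s b).val * X = X * (t b).val
  simp only [X, mul_smul_comm, smul_mul_assoc, Finset.mul_sum, Finset.sum_mul, ← Units.val_mul]
  congr 1
  rw [← Equiv.sum_comp (Equiv.mulLeft b) fun a => ((s a * (t a)⁻¹ * t b : GL n R)).val]
  refine Finset.sum_congr rfl fun a _ => ?_
  congr 1
  simp [mul_assoc]

end Conjugacy

/-! ### Congruence subgroups and their pro-`p` property. -/

section Congruence

open Matrix

variable {R : Type*} [CommRing R] {n : Type*} [Fintype n] [DecidableEq n]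

theorem mem_ker_map_mk_iff (I : Ideal R) (x : GL n R) :
    x ∈ (GeneralLinearGroup.map (n := n) (Ideal.Quotient.mk I)).ker ↔
      ∀ i j, (x.val - 1) i j ∈ I := by
  rw [MonoidHom.mem_ker, GeneralLinearGroup.ext_iff]
  refine forall_congr' fun i => forall_congr' fun j => ?_
  have h1 : (1 : Matrix n n (R ⧸ I)) i j = Ideal.Quotient.mk I ((1 : Matrix n n R) i j) := by
    by_cases h : i = j <;> simp [h, Matrix.one_apply]
  rw [GeneralLinearGroup.coe_one, h1, Matrix.sub_apply, ← Ideal.Quotient.eq]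
  rfl

/-- Factor `X ^ p - 1` as `X - 1` times the geometric sum: the sum has `p` terms congruent to 1
modulo `I`, so it vanishes modulo `I` and gains one power. -/
theorem pow_sub_one_apply_mem {I : Ideal R} {p : ℕ} (hp : (p : R) ∈ I) {k : ℕ} (hk : k ≠ 0)
    {X : Matrix n n R} (hX : ∀ i j, (X - 1) i j ∈ I ^ k) (i j : n) :
    (X ^ p - 1) i j ∈ I ^ (k + 1) := by
  have hX1 : (Ideal.Quotient.mk I).mapMatrix X = 1 := by
    rw [← sub_eq_zero, ← map_one (Ideal.Quotient.mk I).mapMatrix, ← map_sub]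
    ext i j
    exact Ideal.Quotient.eq_zero_iff_mem.2 (Ideal.pow_le_self hk (hX i j))
  have hsum : (Ideal.Quotient.mk I).mapMatrix (∑ l ∈ Finset.range p, X ^ l) = 0 := by
    rw [map_sum, Finset.sum_congr rfl fun l _ => by rw [map_pow, hX1, one_pow]]
    rw [Finset.sum_const, Finset.card_range, ← Nat.cast_smul_eq_nsmul (R ⧸ I),
      ← map_natCast (Ideal.Quotient.mk I), Ideal.Quotient.eq_zero_iff_mem.2 hp, zero_smul]
  rw [← mul_geom_sum, Matrix.mul_apply, pow_succ]
  refine Ideal.sum_mem _ fun l _ => Ideal.mul_mem_mul (hX i l) ?_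
  exact Ideal.Quotient.eq_zero_iff_mem.1 (congrFun (congrFun hsum l) j)

theorem pow_prime_pow_mem_ker_map_mk {I : Ideal R} {p : ℕ} (hp : (p : R) ∈ I) {x : GL n R}
    (hx : x ∈ (GeneralLinearGroup.map (n := n) (Ideal.Quotient.mk I)).ker) (k : ℕ) :
    x ^ p ^ k ∈ (GeneralLinearGroup.map (n := n) (Ideal.Quotient.mk (I ^ (k + 1)))).ker := by
  induction k with
  | zero =>
    rw [mem_ker_map_mk_iff] at hx ⊢
    simpa using hx
  | succ k ih =>
    rw [mem_ker_map_mk_iff] at ih ⊢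
    rw [pow_succ p, pow_mul, Units.val_pow_eq_pow_val]
    exact pow_sub_one_apply_mem hp k.succ_ne_zero ih

theorem isOpen_ker_map_mk [TopologicalSpace R] [IsTopologicalRing R] {I : Ideal R}
    (hI : IsOpen (I : Set R)) :
    IsOpen ((GeneralLinearGroup.map (n := n) (Ideal.Quotient.mk I)).ker : Set (GL n R)) := by
  have : ((GeneralLinearGroup.map (n := n) (Ideal.Quotient.mk I)).ker : Set (GL n R)) =
      ⋂ i, ⋂ j, {x : GL n R | (x.val - 1) i j ∈ I} := by
    ext x
    simp only [Set.mem_iInter]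
    exact mem_ker_map_mk_iff I x
  rw [this]
  refine isOpen_iInter_of_finite fun i => isOpen_iInter_of_finite fun j => ?_
  exact hI.preimage ((Units.continuous_val.sub continuous_const).matrix_elem i j)

theorem ker_map_eq_ker_map_mk {F : Type*} [CommRing F] (π : R →+* F) {I : Ideal R}
    (hI : RingHom.ker π = I) :
    (GeneralLinearGroup.map (n := n) π).ker =
      (GeneralLinearGroup.map (n := n) (Ideal.Quotient.mk I)).ker := by
  ext x
  rw [mem_ker_map_mk_iff, ← hI, MonoidHom.mem_ker, GeneralLinearGroup.ext_iff]
  refine forall_congr' fun i => forall_congr' fun j => ?_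
  rw [RingHom.mem_ker, Matrix.sub_apply, map_sub, sub_eq_zero]
  have h1 : (1 : Matrix n n F) i j = π ((1 : Matrix n n R) i j) := by
    by_cases h : i = j <;> simp [h, Matrix.one_apply]
  rw [GeneralLinearGroup.coe_one, h1]
  rfl

theorem eq_zero_of_forall_mem_pow {I : Ideal R} [IsHausdorff I R] {x : R}
    (hx : ∀ k : ℕ, x ∈ I ^ (k + 1)) : x = 0 := by
  refine IsHausdorff.haus (I := I) ‹_› x fun k => ?_
  rw [SModEq.zero, smul_eq_mul, Ideal.mul_top]
  exact Ideal.pow_le_pow_right k.le_succ (hx k)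

end Congruence

/-! ### Diagonal matrices and lifting a diagonalization. -/

section Diagonal

open Matrix

variable {R : Type*} [CommRing R]

/-- The diagonal matrices in `GL₂(R)`. -/
def diagGL : (Fin 2 → Rˣ) →* GL (Fin 2) R where
  toFun d := ⟨diagonal fun i => (d i).val, diagonal fun i => (d i)⁻¹.val, by simp, by simp⟩
  map_one' := by ext1; simp
  map_mul' d d' := by ext1; simp

theorem coe_diagGL (d : Fin 2 → Rˣ) : (diagGL d).val = diagonal fun i => (d i).val := rfl

theorem map_diagGL {F : Type*} [CommRing F] (π : R →+* F) (d : Fin 2 → Rˣ) :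
    GeneralLinearGroup.map π (diagGL d) = diagGL fun i => Units.map (π : R →* F) (d i) := by
  ext1
  exact diagonal_map (map_zero π)

theorem mul_eq_diagGL_mul {M g : GL (Fin 2) R} {d : Fin 2 → Rˣ}
    (h : ∀ i, vecMul (M.val i) g.val = (d i : R) • M.val i) : M * g = diagGL d * M := by
  ext i j
  rw [Units.val_mul, Units.val_mul, coe_diagGL, diagonal_mul]
  exact congrFun (h i) j

theorem commute_of_eq {M g : GL (Fin 2) R} {d : Fin 2 → Rˣ} (h : M * g = diagGL d * M)
    (hd : d 0 = d 1) (x : GL (Fin 2) R) : g * x = x * g := by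
  have hs : diagGL d = GeneralLinearGroup.scalar (Fin 2) (d 0) := by
    ext i j
    have : ∀ i, d i = d 0 := by
      intro i
      fin_cases i
      · rfl
      · exact hd.symm
    simp [coe_diagGL, this]
  have hg : g = GeneralLinearGroup.scalar (Fin 2) (d 0) := by
    rw [hs, GeneralLinearGroup.scalar_commute] at h
    exact mul_left_cancel h
  rw [hg, GeneralLinearGroup.scalar_commute]

theorem exists_map_eq {F : Type*} [CommRing F] (π : R →+* F) [IsLocalHom π]
    (hπ : Function.Surjective π) {n : Type*} [Fintype n] [DecidableEq n] (Q : GL n F) :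
    ∃ M : GL n R, GeneralLinearGroup.map π M = Q := by
  choose l hl using hπ
  have hX : π.mapMatrix (Matrix.of fun i j => l (Q.val i j)) = Q.val := by
    ext i j
    exact hl _
  have hu : IsUnit (Matrix.of fun i j => l (Q.val i j)) := by
    rw [Matrix.isUnit_iff_isUnit_det]
    apply isUnit_of_map_unit π
    rw [RingHom.map_det, hX, ← Matrix.isUnit_iff_isUnit_det]
    exact Q.isUnit
  exact ⟨hu.unit, Units.ext hX⟩

/-- A diagonalization of the reduction of a representation of a finite group of invertible order
lifts to a diagonalization, given a multiplicative section of the residue map. -/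
theorem exists_diagonalization {F : Type*} [CommRing F] (π : R →+* F) [IsLocalHom π]
    (hπ : Function.Surjective π) {A : Type*} [Group A] [Finite A] (hA : IsUnit (Nat.card A : R))
    (T : Fˣ →* Rˣ) (hT : ∀ x, Units.map (π : R →* F) (T x) = x) (s : A →* GL (Fin 2) R)
    (χ : A →* (Fin 2 → Fˣ)) (Q : GL (Fin 2) F)
    (hQ : ∀ a, Q * GeneralLinearGroup.map π (s a) = diagGL (χ a) * Q) :
    ∃ M : GL (Fin 2) R, GeneralLinearGroup.map π M = Q ∧
      ∀ a, M * s a = diagGL (fun i => T (χ a i)) * M := by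
  obtain ⟨M, hM⟩ := exists_map_eq π hπ Q
  -- The model lift: Teichmüller-type lifts of the eigenvalues, conjugated by an arbitrary lift of
  -- `Q`. Averaging compares it with `s`.
  let t : A →* GL (Fin 2) R :=
    ((MulAut.conj M⁻¹).toMonoidHom.comp diagGL).comp ((T.compLeft (Fin 2)).comp χ)
  have ht (a : A) : t a = M⁻¹ * diagGL (fun i => T (χ a i)) * M := by
    change M⁻¹ * _ * M⁻¹⁻¹ = _
    rw [inv_inv]
    rfl
  obtain ⟨C, hC, hCs⟩ := exists_conj_of_map_eq π hA s t fun a => by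
    rw [ht, map_mul, map_mul, map_inv, hM, map_diagGL, mul_assoc, eq_inv_mul_iff_mul_eq, hQ]
    simp only [hT]
  refine ⟨M * C⁻¹, by rw [map_mul, map_inv, hC, hM, inv_one, mul_one], fun a => ?_⟩
  have h1 : C⁻¹ * s a = t a * C⁻¹ := by
    rw [inv_mul_eq_iff_eq_mul, ← mul_assoc, ← hCs, mul_inv_cancel_right]
  rw [mul_assoc, h1, ht]
  group

end Diagonal

/-! ### Vanishing of an off-diagonal entry. -/

section Frattini

open Matrix

variable {R : Type*} [CommRing R] [TopologicalSpace R] [IsTopologicalRing R]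

/-- Let `α` be an automorphism of `Γ` given by conjugation with a matrix that becomes diagonal in
the basis given by `M`, with distinct residual eigenvalues. If `α` is trivial modulo the
`p`-Frattini subgroup, then `Γ` is lower triangular in that basis. -/
theorem apply_zero_one_eq_zero {I : Ideal R} [IsHausdorff I R]
    (hopen : ∀ k : ℕ, IsOpen ((I ^ k : Ideal R) : Set R)) {p : ℕ} (hp : (p : R) ∈ I)
    {Γ : Subgroup (GL (Fin 2) R)}
    (hΓ : Γ ≤ (GeneralLinearGroup.map (n := Fin 2) (Ideal.Quotient.mk I)).ker)
    {M g : GL (Fin 2) R} {d : Fin 2 → Rˣ} (hM : M * g = diagGL d * M)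
    (hd : IsUnit ((d 0 : R) - d 1)) (α : Γ → Γ) (hα : ∀ γ, (α γ : GL (Fin 2) R) = g * γ * g⁻¹)
    (htriv : ∀ γ, (QuotientGroup.mk (α γ) : Γ ⧸ pFrattini p Γ) = QuotientGroup.mk γ) (γ : Γ) :
    (M * γ * M⁻¹ : GL (Fin 2) R).val 0 1 = 0 := by
  let E : Γ →* GL (Fin 2) R := (MulAut.conj M).toMonoidHom.comp Γ.subtype
  have hE (γ : Γ) : E γ = M * γ * M⁻¹ := rfl
  have hE1 (γ : Γ) (i j : Fin 2) : ((E γ).val - 1) i j ∈ I := by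
    refine (mem_ker_map_mk_iff I _).1 ?_ i j
    exact (MonoidHom.normal_ker _).conj_mem _ (hΓ γ.2) M
  have hα' (γ : Γ) : (d 1 : R) * (E (α γ)).val 0 1 = (d 0 : R) * (E γ).val 0 1 := by
    have h1 : E (α γ) * diagGL d = diagGL d * E γ := by
      have h2 : diagGL d = M * g * M⁻¹ := by rw [hM, mul_inv_cancel_right]
      rw [hE, hE, hα, h2]
      group
    have h2 : (E (α γ)).val * diagonal (fun i => (d i).val) =
        diagonal (fun i => (d i).val) * (E γ).val := congrArg Units.val h1
    have h3 := congrFun (congrFun h2 0) 1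
    rw [diagonal_mul, mul_diagonal] at h3
    rw [mul_comm, h3]
  suffices h : ∀ (k : ℕ) (γ : Γ), (E γ).val 0 1 ∈ I ^ (k + 1) from
    eq_zero_of_forall_mem_pow fun k => h k γ
  intro k
  induction k with
  | zero => intro γ; simpa using hE1 γ 0 1
  | succ k ih =>
    -- Additivity uses the induction hypothesis: the error terms are products of an element of `I`
    -- and one of `I ^ (k + 1)`.
    let θ : Γ →* Multiplicative (R ⧸ I ^ (k + 1 + 1)) :=
      MonoidHom.mk' (fun γ => Multiplicative.ofAdd (Ideal.Quotient.mk _ ((E γ).val 0 1)))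
        fun γ δ => by
          rw [← ofAdd_add, ← map_add]
          refine congrArg Multiplicative.ofAdd (Ideal.Quotient.eq.2 ?_)
          have h1 : (E (γ * δ)).val 0 1 - ((E γ).val 0 1 + (E δ).val 0 1) =
              ((E γ).val - 1) 0 0 * (E δ).val 0 1 + (E γ).val 0 1 * ((E δ).val - 1) 1 1 := by
            rw [map_mul, Units.val_mul, Matrix.mul_apply, Fin.sum_univ_two]
            simp only [Matrix.sub_apply, Matrix.one_apply_eq]
            ring
          rw [h1]
          refine Ideal.add_mem _ ?_ ?_
          · rw [pow_succ']
            exact Ideal.mul_mem_mul (hE1 γ 0 0) (ih δ)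
          · rw [pow_succ]
            exact Ideal.mul_mem_mul (ih γ) (hE1 δ 1 1)
    have hθ (γ : Γ) : γ ∈ θ.ker ↔ (E γ).val 0 1 ∈ I ^ (k + 1 + 1) := by
      rw [MonoidHom.mem_ker, ← Ideal.Quotient.eq_zero_iff_mem]
      rfl
    have hle : pFrattini p Γ ≤ θ.ker := by
      refine Subgroup.topologicalClosure_minimal _ (sup_le ?_ ?_) ?_
      · rw [Subgroup.closure_le]
        rintro _ ⟨x, rfl⟩
        change θ (x ^ p) = 1
        rw [map_pow]
        change Multiplicative.ofAdd (p • Ideal.Quotient.mk (I ^ (k + 1 + 1)) ((E x).val 0 1)) = 1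
        rw [nsmul_eq_mul, ← map_natCast (Ideal.Quotient.mk _), ← map_mul,
          Ideal.Quotient.eq_zero_iff_mem.2, ofAdd_zero]
        rw [pow_succ']
        exact Ideal.mul_mem_mul hp (ih x)
      · exact Abelianization.commutator_subset_ker θ
      · have hset : (θ.ker : Set Γ) = (fun γ : Γ => (E γ).val 0 1) ⁻¹' (I ^ (k + 1 + 1) : Ideal R) := by
          ext γ
          exact hθ γ
        rw [hset]
        have hcl : IsClosed ((I ^ (k + 1 + 1) : Ideal R) : Set R) :=
          (I ^ (k + 1 + 1)).toAddSubgroup.isClosed_of_isOpen (hopen _)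
        refine hcl.preimage (Continuous.matrix_elem (Units.continuous_val.comp ?_) 0 1)
        exact (continuous_const.mul continuous_subtype_val).mul continuous_const
    intro γ
    have h1 := (QuotientGroup.eq.1 (htriv γ).symm)
    have h2 : θ (α γ) = θ γ := by
      have := hle h1
      rw [MonoidHom.mem_ker, map_mul, map_inv, inv_mul_eq_one] at this
      exact this.symm
    have h3 : (E (α γ)).val 0 1 - (E γ).val 0 1 ∈ I ^ (k + 1 + 1) :=
      Ideal.Quotient.eq.1 (Multiplicative.ofAdd.injective h2)
    obtain ⟨u, hu⟩ := hd
    -- By `hα'`, `d 1` times the change of the entry equals `(d 0 - d 1)` times the entry itself,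
    -- and `d 0 - d 1` is a unit.
    have h4 : (E γ).val 0 1 = u⁻¹.val * (d 1 * ((E (α γ)).val 0 1 - (E γ).val 0 1)) := by
      rw [mul_sub, hα', ← sub_mul, ← hu, Units.inv_mul_cancel_left]
    rw [h4]
    exact Ideal.mul_mem_left _ _ (Ideal.mul_mem_left _ _ h3)

end Frattini

open Matrix

/-! ### The residual representation. -/

section Residual

variable {G : Type*} [Group G] {F : Type*} [Field F]

/-- The restriction to `H` of a representation induced from `χ` is diagonal in a suitable basis. -/
theorem exists_diagonal_of_isInducedFrom {H : Subgroup G} [H.Normal] (hH : H.index = 2) {σ : G}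
    (hσ : σ ∉ H) {χ : H →* Fˣ} {ρ : G →* GL (Fin 2) F} (hρ : IsInducedFrom ρ χ) :
    ∃ (Q : GL (Fin 2) F) (ψ : H.map ρ →* (Fin 2 → Fˣ)),
      (∀ h : H, ψ ⟨ρ h, Subgroup.mem_map_of_mem ρ h.2⟩ = ![χ h, χ (MulAut.conjNormal σ h)]) ∧
      (∀ a : H.map ρ, Q * a = diagGL (ψ a) * Q) ∧
      Q.val 1 = vecMul (Q.val 0) (ρ σ).val := by
  obtain ⟨Q, h0, h1, h2⟩ := hρ.exists_rows hH hσ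
  let ψ' : H →* (Fin 2 → Fˣ) :=
    { toFun := fun h => ![χ h, χ (MulAut.conjNormal σ h)]
      map_one' := by
        ext i
        fin_cases i <;> simp
      map_mul' := fun a b => by
        ext i
        fin_cases i <;> simp }
  have hQ (h : H) : Q * ρ h = diagGL (ψ' h) * Q := by
    refine mul_eq_diagGL_mul fun i => ?_
    fin_cases i
    · exact h0 h
    · exact h1 h
  -- The eigenvalues are read off from the matrix `ρ h`, so they descend to characters of the image.
  have hker : (ρ.subgroupMap H).ker ≤ ψ'.ker := by
    intro h hh
    have h3 : ρ h = 1 := congrArg Subtype.val (MonoidHom.mem_ker.1 hh)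
    have h4 := hQ h
    rw [h3, mul_one, right_eq_mul] at h4
    have h5 (i : Fin 2) : (diagonal (fun i => (ψ' h i).val) : Matrix (Fin 2) (Fin 2) F) i i = 1 := by
      rw [← coe_diagGL, h4, Units.val_one, Matrix.one_apply_eq]
    rw [MonoidHom.mem_ker]
    ext i
    simpa using h5 i
  let ψ := (ρ.subgroupMap H).liftOfSurjective (ρ.subgroupMap_surjective H) ⟨ψ', hker⟩
  have hψ (h : H) : ψ ⟨ρ h, Subgroup.mem_map_of_mem ρ h.2⟩ = ψ' h :=
    (ρ.subgroupMap H).liftOfRightInverse_comp_apply _ _ ⟨ψ', hker⟩ h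
  refine ⟨Q, ψ, hψ, ?_, h2⟩
  rintro ⟨_, h, hh, rfl⟩
  rw [hψ ⟨h, hh⟩]
  exact hQ ⟨h, hh⟩

/-- The kernel of an induced representation is contained in `H`. -/
theorem IsInducedFrom.mem_of_apply_eq_one {H : Subgroup G} [H.Normal] (hH : H.index = 2)
    {χ : H →* Fˣ} {ρ : G →* GL (Fin 2) F} (hρ : IsInducedFrom ρ χ) {g : G} (hg : ρ g = 1) :
    g ∈ H := by
  by_contra hgH
  -- With `g` itself as the representative outside `H`, `ρ g = 1` would make the two rows of `Q`
  -- equal.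
  obtain ⟨Q, -, -, h⟩ := hρ.exists_rows hH hgH
  rw [hg, Units.val_one, vecMul_one] at h
  refine GeneralLinearGroup.det_ne_zero Q (det_zero_of_row_eq (i := 0) (j := 1) (by simp) h.symm)

/-- A finite group that acts faithfully by diagonal matrices in characteristic `p` has order prime
to `p`. -/
theorem not_dvd_card_of_diagonal (p : ℕ) [Fact p.Prime] [CharP F p] {A : Subgroup (GL (Fin 2) F)}
    [Finite A] {ψ : A →* (Fin 2 → Fˣ)} {Q : GL (Fin 2) F}
    (hQ : ∀ a : A, Q * a = diagGL (ψ a) * Q) : ¬ p ∣ Nat.card A := by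
  intro hdvd
  obtain ⟨a, ha⟩ := exists_prime_orderOf_dvd_card' p hdvd
  have h1 : ψ a = 1 := by
    ext i
    have h2 : ((ψ a i : Fˣ) : F) ^ p = 1 := by
      have : ψ (a ^ p) = 1 := by rw [← ha, pow_orderOf_eq_one, map_one]
      rw [map_pow] at this
      exact congrArg Units.val (congrFun this i)
    -- By Frobenius, 1 is the only `p`-th root of unity in characteristic `p`.
    have h3 : ((ψ a i : F) - 1) ^ p = 0 := by rw [sub_pow_char, h2, one_pow, sub_self]
    simpa [sub_eq_zero] using pow_eq_zero_iff (Fact.out : p.Prime).ne_zero |>.1 h3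
  have h4 : a = 1 := by
    have := hQ a
    rw [h1, map_one, one_mul, mul_eq_left] at this
    exact Subtype.ext this
  rw [h4, orderOf_one] at ha
  exact (Fact.out : p.Prime).one_lt.ne ha

end Residual

/-! ### The reduction map on `ρ(H)` and its splitting. -/

section Reduction

variable {G : Type*} [Group G] {R : Type*} [CommRing R] {F : Type*} [Field F]
  {π : R →+* F} {ρ : G →* GL (Fin 2) R} {ρbar : G →* GL (Fin 2) F}

theorem map_apply_of_lift (hlift : (GeneralLinearGroup.map (n := Fin 2) π).comp ρ = ρbar) (g : G) :
    GeneralLinearGroup.map π (ρ g) = ρbar g :=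
  DFunLike.congr_fun hlift g

/-- The reduction map `ρ(H) → ρbar(H)`. -/
def reductionHom (hlift : (GeneralLinearGroup.map (n := Fin 2) π).comp ρ = ρbar)
    (H : Subgroup G) : H.map ρ →* H.map ρbar :=
  ((GeneralLinearGroup.map π).comp (H.map ρ).subtype).codRestrict (H.map ρbar) <| by
    rintro ⟨_, h, hh, rfl⟩
    exact ⟨h, hh, (map_apply_of_lift hlift h).symm⟩

theorem coe_reductionHom (hlift : (GeneralLinearGroup.map (n := Fin 2) π).comp ρ = ρbar)
    (H : Subgroup G) (x : H.map ρ) :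
    (reductionHom hlift H x : GL (Fin 2) F) = GeneralLinearGroup.map π x :=
  rfl

theorem reductionHom_surjective (hlift : (GeneralLinearGroup.map (n := Fin 2) π).comp ρ = ρbar)
    (H : Subgroup G) : Function.Surjective (reductionHom hlift H) := by
  rintro ⟨_, h, hh, rfl⟩
  exact ⟨⟨ρ h, h, hh, rfl⟩, Subtype.ext (map_apply_of_lift hlift h)⟩

theorem mem_kernelGamma_iff (π : R →+* F) (ρ : G →* GL (Fin 2) R) (x : GL (Fin 2) R) :
    x ∈ kernelGamma π ρ ↔ x ∈ ρ.range ∧ GeneralLinearGroup.map π x = 1 :=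
  Iff.rfl

theorem continuous_map [TopologicalSpace R] [IsTopologicalRing R] [TopologicalSpace F]
    [DiscreteTopology F] (hπ : IsOpen (RingHom.ker π : Set R)) :
    Continuous (GeneralLinearGroup.map (n := Fin 2) π) := by
  have h : Continuous π := by
    refine continuous_of_continuousAt_zero π ?_
    rw [ContinuousAt, map_zero, nhds_discrete F, Filter.tendsto_pure]
    exact hπ.mem_nhds (by simp)
  exact Continuous.units_map _ (continuous_id.matrix_map h)

theorem continuous_reductionHom [TopologicalSpace R] [IsTopologicalRing R] [TopologicalSpace F]
    [DiscreteTopology F] (hπ : IsOpen (RingHom.ker π : Set R))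
    (hlift : (GeneralLinearGroup.map (n := Fin 2) π).comp ρ = ρbar)
    (H : Subgroup G) : Continuous (reductionHom hlift H) :=
  ((continuous_map hπ).comp continuous_subtype_val).subtype_mk _

theorem exists_isSplitting (p : ℕ) [Fact p.Prime] [Finite F] [TopologicalSpace F]
    [DiscreteTopology F] [TopologicalSpace G] [CompactSpace G] [TopologicalSpace R]
    [IsTopologicalRing R] {I : Ideal R} [IsHausdorff I R]
    (hopen : ∀ k : ℕ, IsOpen ((I ^ k : Ideal R) : Set R)) (hp : (p : R) ∈ I)
    (hπ : RingHom.ker π = I) {H : Subgroup G} (hH : IsClosed (H : Set G)) (hρ : Continuous ρ)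
    (hlift : (GeneralLinearGroup.map (n := Fin 2) π).comp ρ = ρbar)
    (hA : ¬ p ∣ Nat.card (H.map ρbar)) :
    ∃ s : H.map ρbar →* GL (Fin 2) R, IsSplitting π ρ ρbar H s := by
  have hker : IsOpen (RingHom.ker π : Set R) := by
    rw [hπ, ← pow_one I]
    exact hopen 1
  have hcpt : CompactSpace (H.map ρ) :=
    isCompact_iff_compactSpace.1 (hH.isCompact.image hρ)
  -- The shift to `k + 1` keeps every `U k` inside the kernel of reduction.
  let U (k : ℕ) : Subgroup (H.map ρ) :=
    (GeneralLinearGroup.map (n := Fin 2) (Ideal.Quotient.mk (I ^ (k + 1)))).ker.comap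
      (H.map ρ).subtype
  have hU (k : ℕ) (x : H.map ρ) : x ∈ U k ↔ ∀ i j, (x.1.val - 1) i j ∈ I ^ (k + 1) :=
    mem_ker_map_mk_iff _ _
  have hkerU (x : H.map ρ) :
      x ∈ (reductionHom hlift H).ker ↔
        x.1 ∈ (GeneralLinearGroup.map (n := Fin 2) (Ideal.Quotient.mk I)).ker := by
    rw [← ker_map_eq_ker_map_mk π hπ, MonoidHom.mem_ker, MonoidHom.mem_ker, Subtype.ext_iff]
    rfl
  obtain ⟨s, hs⟩ := exists_rightInverse_of_pro_p_ker p hA (reductionHom hlift H)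
    (continuous_reductionHom hker hlift H) (reductionHom_surjective hlift H) U
    (fun k => (isOpen_ker_map_mk (hopen _)).preimage continuous_subtype_val)
    (fun k l hkl x hx => by
      rw [hU] at hx ⊢
      exact fun i j => Ideal.pow_le_pow_right (by omega) (hx i j))
    (fun k x hx => by
      rw [hU] at hx
      rw [hkerU, mem_ker_map_mk_iff]
      exact fun i j => Ideal.pow_le_self k.succ_ne_zero (hx i j))
    (fun x hx => by
      ext i j
      have h1 : (x.1.val - 1) i j = 0 :=
        eq_zero_of_forall_mem_pow fun k => (hU k x).1 (hx k) i j
      rwa [Matrix.sub_apply, sub_eq_zero] at h1)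
    (fun k x hx => ⟨k, pow_prime_pow_mem_ker_map_mk hp ((hkerU x).1 hx) k⟩)
  exact ⟨(H.map ρ).subtype.comp s, fun x => (s x).2, fun x => congrArg Subtype.val (hs x)⟩

end Reduction

/-! ### The direct product decomposition. -/

section Product

/-- A topological group that splits as a normal subgroup and a discrete complement commuting with
it is their product. -/
theorem exists_prod_continuousMulEquiv {X A : Type*} [Group X] [TopologicalSpace X]
    [IsTopologicalGroup X] [Group A] [TopologicalSpace A] [DiscreteTopology A]
    {Γ K : Subgroup X} (s : A →* X) (f : K →* A) (hf : Continuous f) (hs : ∀ a, s a ∈ K)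
    (hΓ : Γ ≤ K) (hfs : ∀ a, f ⟨s a, hs a⟩ = a) (hker : ∀ x : K, x.1 ∈ Γ ↔ f x = 1)
    (hcomm : ∀ a, ∀ γ ∈ Γ, s a * γ = γ * s a) :
    ∃ e : Γ × s.range ≃ₜ* K, ∀ (γ : Γ) (t : s.range), (e (γ, t) : X) = γ * t := by
  have hrange (t : s.range) : t.1 ∈ K := by
    obtain ⟨_, a, rfl⟩ := t
    exact hs a
  have hsf (t : s.range) : s (f ⟨t, hrange t⟩) = t := by
    obtain ⟨_, a, rfl⟩ := t
    exact congrArg s (hfs a)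
  have hfm (γ : Γ) (t : s.range) :
      f ⟨γ * t, K.mul_mem (hΓ γ.2) (hrange t)⟩ = f ⟨t, hrange t⟩ := by
    have h1 := map_mul f ⟨γ, hΓ γ.2⟩ ⟨t, hrange t⟩
    rw [(hker ⟨γ, hΓ γ.2⟩).1 γ.2, one_mul] at h1
    exact h1
  have hinv (x : K) : x.1 * (s (f x))⁻¹ ∈ Γ := by
    refine (hker (x * ⟨s (f x), hs _⟩⁻¹)).2 ?_
    rw [map_mul, map_inv, hfs, mul_inv_cancel]
  have hcs : Continuous fun x : K => s (f x) := continuous_of_discreteTopology.comp hf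
  refine ⟨{
    toFun := fun y => ⟨y.1 * y.2, K.mul_mem (hΓ y.1.2) (hrange y.2)⟩
    invFun := fun x => (⟨x.1 * (s (f x))⁻¹, hinv x⟩, ⟨s (f x), f x, rfl⟩)
    left_inv := ?_
    right_inv := fun x => Subtype.ext (inv_mul_cancel_right _ _)
    map_mul' := ?_
    continuous_toFun := by fun_prop
    continuous_invFun := ?_ }, fun γ t => rfl⟩
  · rintro ⟨γ, t⟩
    ext
    · change γ.1 * t.1 * (s (f _))⁻¹ = _
      rw [hfm, hsf, mul_inv_cancel_right]
    · change s (f _) = _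
      rw [hfm, hsf]
  · rintro ⟨γ, t⟩ ⟨γ', ⟨_, a, rfl⟩⟩
    obtain ⟨_, b, rfl⟩ := t
    apply Subtype.ext
    change γ.1 * γ'.1 * (s b * s a) = γ.1 * s b * (γ'.1 * s a)
    rw [mul_assoc γ.1 (s b), ← mul_assoc (s b), hcomm b _ γ'.2]
    simp only [mul_assoc]
  · exact ((continuous_subtype_val.mul hcs.inv).subtype_mk _).prodMk (hcs.subtype_mk _)

end Product

/-! ### The conjugation action through the adjoint image. -/

section Adjoint

variable {G : Type*} [Group G]

theorem commute_of_asGroupHom_eq_one {F : Type*} [CommRing F] {ρ : G →* GL (Fin 2) F} {h : G}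
    (hh : (adjointRep ρ).asGroupHom h = 1) (X : Matrix (Fin 2) (Fin 2) F) :
    (ρ h).val * X = X * (ρ h).val := by
  have h1 : (adjointRep ρ h) X = X := by
    rw [← Representation.asGroupHom_apply, hh]
    rfl
  have h2 : (ρ h).val * X * ((ρ h)⁻¹).val = X := h1
  rw [← Units.mul_inv_eq_iff_eq_mul]
  exact h2

theorem eigenvalues_eq_of_asGroupHom_eq_one {F : Type*} [CommRing F] {ρ : G →* GL (Fin 2) F}
    {h : G} (hh : (adjointRep ρ).asGroupHom h = 1) {Q : GL (Fin 2) F} {d : Fin 2 → Fˣ}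
    (hQ : Q * ρ h = diagGL d * Q) : d 0 = d 1 := by
  have hD : (diagGL d).val = Q.val * (ρ h).val * Q⁻¹.val := by
    rw [← Units.val_mul, hQ, ← Units.val_mul, mul_inv_cancel_right]
  have hc (N : Matrix (Fin 2) (Fin 2) F) : (diagGL d).val * N = N * (diagGL d).val := by
    have h1 := commute_of_asGroupHom_eq_one hh (Q⁻¹.val * N * Q.val)
    have h2 : Q.val * ((ρ h).val * (Q⁻¹.val * N * Q.val)) * Q⁻¹.val =
        Q.val * (Q⁻¹.val * N * Q.val * (ρ h).val) * Q⁻¹.val := by rw [h1]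
    simp only [← mul_assoc, Units.mul_inv_cancel_right, Units.mul_inv, one_mul] at h2
    rw [hD, h2]
    simp only [mul_assoc]
  -- Commuting with the elementary matrix at position `(0, 1)` forces the diagonal entries to agree.
  have h3 := congrFun (congrFun (hc !![0, 1; 0, 0]) 0) 1
  rw [coe_diagGL, diagonal_mul, mul_diagonal] at h3
  ext
  simpa using h3

variable {R : Type*} [CommRing R] {F : Type*} [Field F]
  {π : R →+* F} {ρ : G →* GL (Fin 2) R} {ρbar : G →* GL (Fin 2) F} {H : Subgroup G}
  {s : H.map ρbar →* GL (Fin 2) R}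

theorem IsSplitting.mem_range (hs : IsSplitting π ρ ρbar H s) (a : H.map ρbar) : s a ∈ ρ.range := by
  obtain ⟨h, -, hh⟩ := hs.mem_image a
  exact ⟨h, hh⟩

theorem conj_mem_kernelGamma {x γ : GL (Fin 2) R} (hx : x ∈ ρ.range) (hγ : γ ∈ kernelGamma π ρ) :
    x * γ * x⁻¹ ∈ kernelGamma π ρ :=
  ⟨mul_mem (mul_mem hx hγ.1) (ρ.range.inv_mem hx), (MonoidHom.normal_ker _).conj_mem _ hγ.2 x⟩

/-- The conjugation action on `Γ_ρ` factors through the adjoint image as soon as `s` has central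
values on the kernel of the adjoint representation. -/
theorem IsSplitting.exists_isConjAction (hs : IsSplitting π ρ ρbar H s)
    (hcomm : ∀ (h : G) (hh : h ∈ H), (adjointRep ρbar).asGroupHom h = 1 →
      ∀ x, s ⟨ρbar h, Subgroup.mem_map_of_mem _ hh⟩ * x =
        x * s ⟨ρbar h, Subgroup.mem_map_of_mem _ hh⟩) :
    ∃ act : adImage ρbar H →* MulAut (kernelGamma π ρ), IsConjAction π ρ ρbar H s act := by
  have hnorm (a : H.map ρbar) :
      s a ∈ Subgroup.normalizer (kernelGamma π ρ : Set (GL (Fin 2) R)) := by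
    rw [Subgroup.mem_normalizer_iff]
    refine fun γ => ⟨conj_mem_kernelGamma (hs.mem_range a), fun h => ?_⟩
    have := conj_mem_kernelGamma (inv_mem (hs.mem_range a)) h
    rwa [inv_inv, ← mul_assoc, ← mul_assoc, inv_mul_cancel, one_mul, inv_mul_cancel_right] at this
  let c : H →* MulAut (kernelGamma π ρ) :=
    (kernelGamma π ρ).normalizerMonoidHom.comp ((s.codRestrict _ hnorm).comp (ρbar.subgroupMap H))
  have hc (h : H) (γ : kernelGamma π ρ) : (c h γ : GL (Fin 2) R) =
      s ⟨ρbar h, Subgroup.mem_map_of_mem _ h.2⟩ * γ *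
        (s ⟨ρbar h, Subgroup.mem_map_of_mem _ h.2⟩)⁻¹ := rfl
  have hker : ((adjointRep ρbar).asGroupHom.subgroupMap H).ker ≤ c.ker := by
    intro h hh
    rw [MonoidHom.mem_ker]
    ext1 γ
    apply Subtype.ext
    rw [hc, hcomm h h.2 (congrArg Subtype.val (MonoidHom.mem_ker.1 hh)), mul_inv_cancel_right]
    rfl
  refine ⟨((adjointRep ρbar).asGroupHom.subgroupMap H).liftOfSurjective
    ((adjointRep ρbar).asGroupHom.subgroupMap_surjective H) ⟨c, hker⟩, fun h hh γ => ?_⟩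
  have h1 := ((adjointRep ρbar).asGroupHom.subgroupMap H).liftOfRightInverse_comp_apply _
    (Function.rightInverse_surjInv ((adjointRep ρbar).asGroupHom.subgroupMap_surjective H))
    ⟨c, hker⟩ ⟨h, hh⟩
  have h2 := congrArg (fun φ : MulAut (kernelGamma π ρ) => (φ γ : GL (Fin 2) R)) h1
  exact h2

end Adjoint

/-! ### The character of a lower triangular image. -/

section Triangular

variable {G : Type*} [Group G] {R : Type*} [CommRing R] {ρ : G →* GL (Fin 2) R} {H : Subgroup G}

/-- If `H` is lower triangular in the basis given by `M`, then it acts on the first row of `M`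
through a character. -/
theorem exists_char_of_apply_zero_one_eq_zero {M : GL (Fin 2) R}
    (h0 : ∀ h : H, (M * ρ h * M⁻¹ : GL (Fin 2) R).val 0 1 = 0) :
    ∃ χ : H →* Rˣ, (∀ h, (χ h : R) = (M * ρ h * M⁻¹ : GL (Fin 2) R).val 0 0) ∧
      ∀ h : H, vecMul (M.val 0) (ρ h).val = (χ h : R) • M.val 0 := by
  let E : H →* GL (Fin 2) R := (MulAut.conj M).toMonoidHom.comp (ρ.comp H.subtype)
  have hE (h : H) : E h = M * ρ h * M⁻¹ := rfl
  let c : H →* R :=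
    { toFun := fun h => (E h).val 0 0
      map_one' := by simp
      map_mul' := fun a b => by
        have ha : (E a).val 0 1 = 0 := h0 a
        rw [map_mul, Units.val_mul, Matrix.mul_apply, Fin.sum_univ_two, ha, zero_mul, add_zero] }
  refine ⟨c.toHomUnits, fun h => rfl, fun h => ?_⟩
  have h1 : M.val * (ρ h).val = (E h).val * M.val := by
    rw [← Units.val_mul, ← Units.val_mul, hE, inv_mul_cancel_right]
  ext j
  have h2 := congrFun (congrFun h1 0) j
  rw [Matrix.mul_apply (M := (E h).val), Fin.sum_univ_two, hE, h0, zero_mul, add_zero] at h2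
  exact h2

theorem continuous_char [TopologicalSpace G] [TopologicalSpace R] [IsTopologicalRing R]
    (hρ : Continuous ρ) {M : GL (Fin 2) R} {χ : H →* Rˣ}
    (hχ : ∀ h, (χ h : R) = (M * ρ h * M⁻¹ : GL (Fin 2) R).val 0 0)
    [ContinuousInv H] : Continuous χ := by
  have h1 : Continuous fun h : H => (χ h : R) := by
    simp only [hχ]
    refine Continuous.matrix_elem (Units.continuous_val.comp ?_) 0 0
    exact (continuous_const.mul (hρ.comp continuous_subtype_val)).mul continuous_const
  refine Units.continuous_iff.2 ⟨h1, ?_⟩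
  simp only [← map_inv]
  exact h1.comp continuous_inv

end Triangular

/-! ### Teichmüller lifts of residual eigenvalues. -/

section Teichmuller

variable (p : ℕ) [Fact p.Prime] {F R : Type*} [CommRing F] [CommRing R] [Algebra (WittVector p F) R]

/-- The Teichmüller map to the units of a `W(F)`-algebra. -/
noncomputable def teichmullerUnits : Fˣ →* Rˣ :=
  Units.map ((algebraMap (WittVector p F) R : WittVector p F →* R).comp (WittVector.teichmuller p))

theorem map_teichmullerUnits {π : R →+* F}
    (hπ : ∀ w : WittVector p F, π (algebraMap (WittVector p F) R w) = WittVector.constantCoeff w)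
    (x : Fˣ) : Units.map (π : R →* F) (teichmullerUnits p x) = x := by
  ext
  exact (hπ _).trans (WittVector.teichmuller_coeff_zero p _)

end Teichmuller

end DihedralLift

/-! ### Assembly of the theorem. -/

open DihedralLift in
theorem theorem1p1
    (p : ℕ) [Fact p.Prime]
    {F : Type*} [Field F] [Finite F] [CharP F p] [TopologicalSpace F] [DiscreteTopology F]
    {G : Type*} [Group G] [TopologicalSpace G] [IsTopologicalGroup G]
    [CompactSpace G] [T2Space G] [TotallyDisconnectedSpace G]
    (H : Subgroup G) [H.Normal] (hHopen : IsOpen (H : Set G)) (hHindex : H.index = 2)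
    (σ : G) (hσ : σ ∉ H)
    (χbar : H →* Fˣ) (hχbar : Continuous χbar)
    (hχσ : χbar.comp (MulAut.conjNormal σ : MulAut H).toMonoidHom ≠ χbar)
    (ρbar : G →* GL (Fin 2) F) (hρbar : Continuous ρbar) (hind : IsInducedFrom ρbar χbar)
    {R : Type*} [CommRing R] [IsLocalRing R] [IsNoetherianRing R]
    [IsAdicComplete (IsLocalRing.maximalIdeal R) R]
    [TopologicalSpace R] [IsTopologicalRing R] (hadic : IsAdic (IsLocalRing.maximalIdeal R))
    [Algebra (WittVector p F) R]
    (π : R →+* F) (hπ : Function.Surjective π)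
    (hπW : ∀ w : WittVector p F, π (algebraMap (WittVector p F) R w) = WittVector.constantCoeff w)
    (ρ : G →* GL (Fin 2) R) (hρ : Continuous ρ)
    (hlift : (Matrix.GeneralLinearGroup.map (n := Fin 2) π).comp ρ = ρbar) :
    (∃ s : H.map ρbar →* GL (Fin 2) R, IsSplitting π ρ ρbar H s) ∧
    ∀ s : H.map ρbar →* GL (Fin 2) R, IsSplitting π ρ ρbar H s →
      ∃ act : adImage ρbar H →* MulAut (kernelGamma π ρ),
        IsConjAction π ρ ρbar H s act ∧
        List.TFAE [
          ∃ χ : H →* Rˣ, Continuous χ ∧ (Units.map (π : R →* F)).comp χ = χbar ∧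
            IsInducedFrom ρ χ,
          ∀ (a : adImage ρbar H) (γ : kernelGamma π ρ), act a γ = γ,
          ∀ (a : adImage ρbar H) (γ : kernelGamma π ρ),
            (QuotientGroup.mk (act a γ) : kernelGamma π ρ ⧸ pFrattini p (kernelGamma π ρ)) =
              QuotientGroup.mk γ] ∧
        ((∀ (a : adImage ρbar H) (γ : kernelGamma π ρ), act a γ = γ) →
          ∃ e : kernelGamma π ρ × s.range ≃ₜ* H.map ρ,
            ∀ (γ : kernelGamma π ρ) (t : s.range),
              (e (γ, t) : GL (Fin 2) R) = (γ : GL (Fin 2) R) * (t : GL (Fin 2) R)) := by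
  obtain ⟨Q, ψ, hψ, hQ, hQσ⟩ := exists_diagonal_of_isInducedFrom hHindex hσ hind
  have hcard : ¬ p ∣ Nat.card (H.map ρbar) := not_dvd_card_of_diagonal p hQ
  have hker : RingHom.ker π = IsLocalRing.maximalIdeal R := IsLocalRing.ker_eq_maximalIdeal π hπ
  have hloc : IsLocalHom π := .of_surjective _ hπ
  have hpm : (p : R) ∈ IsLocalRing.maximalIdeal R := by
    rw [← hker, RingHom.mem_ker, map_natCast, CharP.cast_eq_zero]
  have hopen (k : ℕ) : IsOpen ((IsLocalRing.maximalIdeal R ^ k : Ideal R) : Set R) :=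
    (isAdic_iff.1 hadic).1 k
  have hkopen : IsOpen (RingHom.ker π : Set R) := by
    rw [hker, ← pow_one (IsLocalRing.maximalIdeal R)]
    exact hopen 1
  have hunit : IsUnit (Nat.card (H.map ρbar) : R) := by
    apply isUnit_of_map_unit π
    rw [map_natCast, isUnit_iff_ne_zero, Ne, CharP.cast_eq_zero_iff F p]
    exact hcard
  have hlift' (g : G) := map_apply_of_lift hlift g
  have hΓH : kernelGamma π ρ ≤ H.map ρ := by
    rintro _ ⟨⟨g, rfl⟩, hg⟩
    refine ⟨g, hind.mem_of_apply_eq_one hHindex ?_, rfl⟩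
    rw [← hlift']
    exact hg
  refine ⟨exists_isSplitting p hopen hpm hker (H.isClosed_of_isOpen hHopen) hρ hlift hcard,
    fun s hs => ?_⟩
  obtain ⟨M, hMQ, hM⟩ := exists_diagonalization π hπ hunit (teichmullerUnits p)
    (map_teichmullerUnits p hπW) s ψ Q fun a => by rw [hs.reduction, hQ]
  -- Equal residual eigenvalues have equal Teichmüller lifts, so `s (ρbar h)` is scalar.
  obtain ⟨act, hact⟩ := hs.exists_isConjAction fun h hh hone x =>
    commute_of_eq (hM _) (congrArg _ (eigenvalues_eq_of_asGroupHom_eq_one hone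
      (hQ ⟨ρbar h, Subgroup.mem_map_of_mem _ hh⟩))) x
  refine ⟨act, hact, ?_, fun htriv => ?_⟩
  · tfae_have 1 → 2 := by
      rintro ⟨χ, -, -, hχ⟩ ⟨_, h, hh, rfl⟩ γ
      apply Subtype.ext
      rw [hact h hh]
      obtain ⟨g, hg, hgγ⟩ := hΓH γ.2
      obtain ⟨k, hk, hks⟩ := hs.mem_image ⟨ρbar h, Subgroup.mem_map_of_mem _ hh⟩
      rw [← hgγ, ← hks, hχ.commute hk hg, mul_inv_cancel_right]
    tfae_have 2 → 3 := fun h a γ => by rw [h]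
    tfae_have 3 → 1 := by
      intro htriv
      obtain ⟨h₀, hh₀⟩ : ∃ h, χbar (MulAut.conjNormal σ h) ≠ χbar h := by
        by_contra! h
        exact hχσ (MonoidHom.ext h)
      have hT (x : Fˣ) : π (teichmullerUnits p x : Rˣ) = x :=
        congrArg Units.val (map_teichmullerUnits p hπW x)
      have hlower (γ : kernelGamma π ρ) : (M * γ * M⁻¹ : GL (Fin 2) R).val 0 1 = 0 := by
        refine apply_zero_one_eq_zero hopen hpm ?_
          (hM ⟨ρbar h₀, Subgroup.mem_map_of_mem _ h₀.2⟩) ?_ _ (hact h₀ h₀.2) (htriv _) γ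
        · rw [← ker_map_eq_ker_map_mk π hker]
          exact inf_le_right
        · apply isUnit_of_map_unit π
          rw [map_sub, hT, hT, hψ, isUnit_iff_ne_zero, sub_ne_zero]
          exact fun h => hh₀ (Units.ext h.symm)
      obtain ⟨χ, hχ, hrow⟩ := exists_char_of_apply_zero_one_eq_zero (ρ := ρ) (H := H) (M := M) <| by
        intro h
        let a : H.map ρbar := ⟨ρbar h, Subgroup.mem_map_of_mem _ h.2⟩
        -- Every `ρ h` is an element of `Γ_ρ` times `s a`, and the latter is diagonal in the basis
        -- `M`.
        have hγ : ρ h * (s a)⁻¹ ∈ kernelGamma π ρ := by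
          refine ⟨mul_mem ⟨h, rfl⟩ (ρ.range.inv_mem (hs.mem_range a)), ?_⟩
          change Matrix.GeneralLinearGroup.map π _ = 1
          rw [map_mul, map_inv, hs.reduction, hlift', mul_inv_cancel]
        have h1 : M * ρ h * M⁻¹ =
            M * (ρ h * (s a)⁻¹) * M⁻¹ * diagGL (fun i => teichmullerUnits p (ψ a i)) := by
          rw [eq_mul_inv_of_mul_eq (hM a).symm]
          group
        rw [h1, Units.val_mul, coe_diagGL, Matrix.mul_diagonal, hlower ⟨_, hγ⟩, zero_mul]
      refine ⟨χ, continuous_char hρ hχ, ?_, isInducedFrom_of_row hHindex hσ _ hrow ?_⟩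
      · ext h
        change π (χ h) = χbar h
        have h1 : Q * ρbar h * Q⁻¹ = diagGL (ψ ⟨ρbar h, Subgroup.mem_map_of_mem _ h.2⟩) :=
          mul_inv_eq_of_eq_mul (hQ ⟨ρbar h, Subgroup.mem_map_of_mem _ h.2⟩)
        rw [hχ, ← Matrix.GeneralLinearGroup.map_apply, map_mul, map_mul, map_inv, hMQ, hlift', h1,
          hψ, coe_diagGL, Matrix.diagonal_apply_eq]
        rfl
      -- Only the first row of `M` enters; the second row of `Q` is the `σ`-translate of its first,
      -- so the matrix reduces to `Q`.
      · have h1 : π.mapMatrix (Matrix.of ![M.val 0, Matrix.vecMul (M.val 0) (ρ σ).val]) = Q.val := by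
          have hM0 (j : Fin 2) : π (M.val 0 j) = Q.val 0 j := by
            rw [← hMQ]
            rfl
          ext i j
          fin_cases i
          · exact hM0 j
          · change π (Matrix.vecMul (M.val 0) (ρ σ).val j) = Q.val 1 j
            rw [hQσ, RingHom.map_vecMul, ← hlift']
            congr 1
            exact funext hM0
        rw [Matrix.isUnit_iff_isUnit_det]
        apply isUnit_of_map_unit π
        rw [RingHom.map_det, h1, ← Matrix.isUnit_iff_isUnit_det]
        exact Q.isUnit
    tfae_finish
  · refine exists_prod_continuousMulEquiv s (reductionHom hlift H)
      (continuous_reductionHom hkopen hlift H) hs.mem_image hΓH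
      (fun a => Subtype.ext (hs.reduction a)) (fun x => ?_) ?_
    · rw [mem_kernelGamma_iff, Subtype.ext_iff, coe_reductionHom]
      refine ⟨fun h => h.2, fun h => ⟨?_, h⟩⟩
      obtain ⟨g, -, hg⟩ := x.2
      exact ⟨g, hg⟩
    · rintro ⟨_, h, hh, rfl⟩ γ hγ
      have h1 := hact h hh ⟨γ, hγ⟩
      rw [htriv] at h1
      exact (eq_mul_inv_iff_mul_eq.1 h1).symm
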